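/- **Theorem (Fermionic Lieb–Robinson bound).** Let $V$ be a finite set of sites and let $f_j, f_j^\dagger$ ($j\in V$) be the fermionic annihilation and creation operators on the Fock space over $V$, so that $\{f_j,f_k^\dagger\}=\delta_{jk}$ and $\{f_j,f_k\}=0$. For $X\subset V$ let $\mathcal G_X$ be the algebra of even polynomials in the operators of $X$, i.e. the complex linear span of the products of an even number of operators $f_j,f_j^\dagger$ with $j\in X$. Let $E$ be a set of subsets (hyperedges) of $V$. Put $$\mathcal Z=\max_{X\in E}\bigl|\{Y\in E: Y\cap X\neq\emptyset\}\bigr|$$ (with $\mathcal Z=0$ if $E=\emptyset$). For $X,Y\subset V$ let $d(X,Y)=0$ if $X\cap Y\ne\emptyset$; otherwise let $d(X,Y)$ be the least number of hyperedges in a sequence of elements of $E$ such that the first meets $X$, consecutive ones meet each other, and the last meets $Y$ ($d(X,Y)=\infty$ if there is no such sequence). For $X\in E$ let $H_X:\mathbb R\to\mathcal G_X$ be piecewise continuous with $H_X(r)$ Hermitian and $\|H_X(r)\|\le b$ in operator norm for all $r\in\mathbb R$. Let $H=\sum_{X\in E}H_X$. Let $\tau_{s,t}$ be the Heisenberg picture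 propagator of $H$, the solution, continuous in $s$, of $$\frac{\mathrm d}{\mathrm ds}\tau_{s,t}(A)=-i\,[H(s),\tau_{s,t}(A)],\qquad \tau_{t,t}(A)=A,$$ at all times $s$ at which $H$ is continuous. Let $$v=e\,\mathcal Z\,\sup_{X\in E,\,r\in\mathbb R}\|\mathcal L_X(r)\|,\qquad \mathcal L_X(r)=i[H_X(r),\,\cdot\,],$$ be the Lieb–Robinson speed, where $\|\mathcal L_X(r)\|$ is the norm of this superoperator induced by the operator norm (the supremum is $0$ if $E=\emptyset$). Then $v\le 2e\,b\,\mathcal Z$, and for all $X,Y\subset V$, $A_X\in\mathcal G_X$, $B_Y\in\mathcal G_Y$ and $s,t\in\mathbb R$, $$\bigl\|[B_Y,\tau_{s,t}(A_X)]\bigr\|\le C\,\|B_Y\|\,\|A_X\|\,e^{v|t-s|-d(X,Y)},$$ where $C=p(\min\{|X|,|Y|\})$ for a universal polynomial $p$ (independent of $V,E,H,b,A_X,B_Y,s,t$), and $e^{-\infty}=0$. -/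

import Mathlib

open scoped BigOperators

namespace FermionLattice

noncomputable section

/-! ### Fermions on a finite set of sites -/

/-- The fermionic Fock space over the modes `V`: the orthonormal basis vectors are labelled by the
sets of occupied modes. -/
abbrev Fock (V : Type*) [Fintype V] [LinearOrder V] : Type _ :=
  EuclideanSpace ℂ (Finset V)

/-- The algebra of (bounded) linear operators on Fock space, with the operator norm; `star` is the
adjoint. -/
abbrev Op (V : Type*) [Fintype V] [LinearOrder V] : Type _ :=
  Fock V →L[ℂ] Fock V

/-- The fermionic sign `(-1) ^ #{i ∈ S | i < j}`, with respect to the chosen ordering of modes. -/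
def sgn {V : Type*} [LinearOrder V] (j : V) (S : Finset V) : ℂ :=
  (-1) ^ (S.filter (fun i => i < j)).card

/-- The annihilation operator `f_j`: it sends the basis vector `|S⟩` to
`(-1) ^ #{i ∈ S | i < j} |S \ {j}⟩` if `j ∈ S`, and to `0` otherwise. Written in coordinates. -/
def annihilation {V : Type*} [Fintype V] [LinearOrder V] (j : V) : Op V :=
  LinearMap.toContinuousLinearMap
    { toFun := fun ψ => WithLp.toLp 2 (fun T : Finset V =>
        if j ∈ T then 0 else sgn j T * ψ (insert j T))
      map_add' := by
        intro ψ φ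
        ext T
        by_cases h : j ∈ T <;> simp [h, mul_add]
      map_smul' := by
        intro c ψ
        ext T
        by_cases h : j ∈ T <;> simp [h, mul_left_comm] }

/-- The creation operator, the adjoint of the annihilation operator. -/
def creation {V : Type*} [Fintype V] [LinearOrder V] (j : V) : Op V :=
  star (annihilation j)

theorem annihilation_apply {V : Type*} [Fintype V] [LinearOrder V] (j : V) (ψ : Fock V)
    (T : Finset V) :
    annihilation j ψ T = if j ∈ T then 0 else sgn j T * ψ (insert j T) := rfl

theorem sgn_mul_self {V : Type*} [LinearOrder V] (j : V) (S : Finset V) :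
    sgn j S * sgn j S = 1 := by
  unfold sgn
  rw [← mul_pow]
  simp

theorem sgn_insert {V : Type*} [LinearOrder V] (j k : V) (S : Finset V) (hk : k ∉ S) :
    sgn j (insert k S) = if k < j then - sgn j S else sgn j S := by
  unfold sgn
  rw [Finset.filter_insert]
  split_ifs with h
  · rw [Finset.card_insert_of_notMem (by simp [hk]), pow_succ]; ring
  · rfl

theorem creation_apply {V : Type*} [Fintype V] [LinearOrder V] (j : V) (ψ : Fock V)
    (T : Finset V) :
    creation j ψ T = if j ∈ T then sgn j (T.erase j) * ψ (T.erase j) else 0 := by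
  have h1 : creation j ψ T
      = inner ℂ (EuclideanSpace.single T (1 : ℂ)) (creation j ψ) := by
    simp [EuclideanSpace.inner_single_left]
  rw [h1, creation, ContinuousLinearMap.star_eq_adjoint,
    ContinuousLinearMap.adjoint_inner_right, PiLp.inner_apply]
  simp only [annihilation_apply]
  split_ifs with h
  · rw [Finset.sum_eq_single (T.erase j)]
    · simp [Finset.insert_erase h, sgn, mul_comm]
    · intro S _ hS
      by_cases hj : j ∈ S
      · simp [hj]
      · have : insert j S ≠ T := by
          rintro rfl
          exact hS (by simp [hj])
        simp [this]
    · simp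
  · apply Finset.sum_eq_zero
    intro S _
    have : insert j S ≠ T := by
      rintro rfl
      simp at h
    simp [this]

/-- Canonical anticommutation relation `{f_j, f_k} = 0`. -/
theorem anticomm_annihilation {V : Type*} [Fintype V] [LinearOrder V] (j k : V) :
    annihilation j * annihilation k + annihilation k * annihilation j = 0 := by
  ext ψ T
  change annihilation j (annihilation k ψ) T + annihilation k (annihilation j ψ) T = 0
  simp only [annihilation_apply]
  rcases lt_trichotomy j k with h | rfl | h
  · by_cases hj : j ∈ T <;> by_cases hk : k ∈ T <;>
      simp [hj, hk, h.ne, h.ne', sgn_insert, h, h.not_gt, Finset.insert_comm k j]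
    ring
  · simp
  · by_cases hj : j ∈ T <;> by_cases hk : k ∈ T <;>
      simp [hj, hk, h.ne, h.ne', sgn_insert, h, h.not_gt, Finset.insert_comm k j]
    ring

/-- Canonical anticommutation relation `{f_j, f_k†} = δ_{jk}`. -/
theorem anticomm_annihilation_creation {V : Type*} [Fintype V] [LinearOrder V] (j k : V) :
    annihilation j * creation k + creation k * annihilation j
      = if j = k then (1 : Op V) else 0 := by
  ext ψ T
  change annihilation j (creation k ψ) T + creation k (annihilation j ψ) T = _
  simp only [annihilation_apply, creation_apply]
  by_cases hjk : j = k
  · subst hjk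
    by_cases hj : j ∈ T
    · simp [hj, ← mul_assoc, sgn_mul_self, Finset.insert_erase hj]
    · simp [hj, ← mul_assoc, sgn_mul_self]
  · by_cases hk : k ∈ T
    · by_cases hj : j ∈ T
      · simp [hj, hk, hjk]
      · obtain ⟨S, hkS, rfl⟩ : ∃ S, k ∉ S ∧ insert k S = T :=
          ⟨T.erase k, by simp, Finset.insert_erase hk⟩
        have hjS : j ∉ S := fun h => hj (by simp [h])
        have hkj : k ∉ insert j S := by simp [hkS, Ne.symm hjk]
        have e : (insert j (insert k S)).erase k = insert j S := by
          rw [Finset.insert_comm, Finset.erase_insert hkj]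
        simp only [hj, if_false, hjk, e, Finset.erase_insert hkS, sgn_insert _ _ _ hkS, hjS,
          sgn_insert _ _ _ hjS, Finset.mem_insert_self, Finset.mem_insert_of_mem, if_true]
        rcases lt_or_gt_of_ne hjk with h | h
        · simp [h, h.not_gt]; ring
        · simp [h, h.not_gt]; ring
    · simp [hk, hjk, Ne.symm hjk]

/-- The fermionic generators of the region `X`: all `f_j` and `f_j†` with `j ∈ X`. -/
def generators {V : Type*} [Fintype V] [LinearOrder V] (X : Finset V) : Set (Op V) :=
  {a | ∃ j ∈ X, a = annihilation j ∨ a = creation j}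

/-- The algebra `𝒢_X` of even polynomials in the fermionic operators of the region `X`: the linear
combinations of monomials, each a product of an even number of operators `f_j`, `f_j†`, `j ∈ X`. -/
def evenAlgebra {V : Type*} [Fintype V] [LinearOrder V] (X : Finset V) : Submodule ℂ (Op V) :=
  Submodule.span ℂ {m | ∃ l : List (Op V), (∀ a ∈ l, a ∈ generators X) ∧ Even l.length ∧ m = l.prod}

/-! ### The interaction hypergraph -/

/-- `l` is a path from `X` to `Y` in the hypergraph with set of hyperedges `E`: a (non-empty)
sequence of hyperedges, the first meeting `X`, consecutive ones meeting each other, the last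
meeting `Y`. -/
def IsPath {V : Type*} [DecidableEq V] (E : Finset (Finset V)) (X Y : Finset V)
    (l : List (Finset V)) : Prop :=
  (∀ e ∈ l, e ∈ E) ∧ l.IsChain (fun e e' => (e ∩ e').Nonempty) ∧
    (∃ e ∈ l.head?, (e ∩ X).Nonempty) ∧ (∃ e ∈ l.getLast?, (e ∩ Y).Nonempty)

/-- The interaction graph distance: `0` if the sets intersect, otherwise the number of hyperedges in
a shortest connecting path, and `⊤` if there is none. -/
def graphDist {V : Type*} [DecidableEq V] (E : Finset (Finset V)) (X Y : Finset V) : ℕ∞ :=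
  if (X ∩ Y).Nonempty then 0 else sInf {n : ℕ∞ | ∃ l, IsPath E X Y l ∧ n = l.length}

/-- The maximum number of nearest neighbours `𝒵 = max_{X ∈ E} #{Y ∈ E | Y ∩ X ≠ ∅}`. -/
def maxNeighbors {V : Type*} [DecidableEq V] (E : Finset (Finset V)) : ℕ :=
  E.sup (fun X => (E.filter (fun Y => (Y ∩ X).Nonempty)).card)

/-! ### Time-dependent local Hamiltonians and their Heisenberg dynamics -/

/-- A function on the real line is piecewise continuous if its discontinuities are isolated (finitely
many in every bounded interval) and all one-sided limits exist. -/
def PiecewiseContinuous {F : Type*} [TopologicalSpace F] (f : ℝ → F) : Prop :=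
  (∀ a b : ℝ, {r ∈ Set.Icc a b | ¬ ContinuousAt f r}.Finite) ∧
    ∀ r : ℝ, (∃ y, Filter.Tendsto f (nhdsWithin r (Set.Iio r)) (nhds y)) ∧
      ∃ y, Filter.Tendsto f (nhdsWithin r (Set.Ioi r)) (nhds y)

/-- The terms `H_X : ℝ → 𝒢_X`, `X ∈ E`, are Hermitian, parity preserving, and piecewise
continuous in time. -/
structure IsLocalHamiltonian {V : Type*} [Fintype V] [LinearOrder V] (E : Finset (Finset V))
    (H : Finset V → ℝ → Op V) : Prop where
  mem_even : ∀ X ∈ E, ∀ r, H X r ∈ evenAlgebra X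
  isSelfAdjoint : ∀ X ∈ E, ∀ r, IsSelfAdjoint (H X r)
  piecewiseContinuous : ∀ X ∈ E, PiecewiseContinuous (H X)

/-- The full Hamiltonian `H(r) = ∑_{X ∈ E} H_X(r)`. -/
def totalHamiltonian {V : Type*} [Fintype V] [LinearOrder V] (E : Finset (Finset V))
    (H : Finset V → ℝ → Op V) (r : ℝ) : Op V :=
  ∑ X ∈ E, H X r

/-- The Liouvillian `A ↦ i [K, A]` in the Heisenberg picture, a superoperator; its norm is the
operator norm with respect to the operator norm on `Op V`. -/
def liouvillian {V : Type*} [Fintype V] [LinearOrder V] (K : Op V) : Op V →L[ℂ] Op V :=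
  Complex.I • (ContinuousLinearMap.mul ℂ (Op V) K - (ContinuousLinearMap.mul ℂ (Op V)).flip K)

/-- `τ` is the Heisenberg picture propagator of the time-dependent Hamiltonian `K`: it is the
(continuous) solution of `d/ds τ(s,t) = - ℒ_s τ(s,t)`, `τ(t,t) = id`, with `ℒ_s = i [K(s), ·]`, where
the differential equation is required at the times at which `K` is continuous. -/
structure IsPropagator {V : Type*} [Fintype V] [LinearOrder V] (K : ℝ → Op V)
    (τ : ℝ → ℝ → Op V →L[ℂ] Op V) : Prop where
  self : ∀ t, τ t t = ContinuousLinearMap.id ℂ (Op V)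
  continuous : ∀ t A, Continuous (fun s => τ s t A)
  hasDerivAt : ∀ t A s, ContinuousAt K s →
    HasDerivAt (fun s' => τ s' t A) (-(liouvillian (K s) (τ s t A))) s

/-- The supremum over all times and all hyperedges of the norm of the local Liouvillian
`i [H_X(r), ·]`. -/
def liouvillianBound {V : Type*} [Fintype V] [LinearOrder V] (E : Finset (Finset V))
    (H : Finset V → ℝ → Op V) : ℝ :=
  ⨆ q : E × ℝ, ‖liouvillian (H q.1 q.2)‖

/-- The Lieb-Robinson speed: Euler's number, times the supremum of the norms of the local
Liouvillians, times the maximum number of nearest neighbours. -/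
def liebRobinsonSpeed {V : Type*} [Fintype V] [LinearOrder V] (E : Finset (Finset V))
    (H : Finset V → ℝ → Op V) : ℝ :=
  Real.exp 1 * liouvillianBound E H * maxNeighbors E

/-- `e ^ (x - d)` for a real `x` and a distance `d` that may be infinite, with `e ^ (-∞) = 0`. -/
def expSub (x : ℝ) : ℕ∞ → ℝ
  | (⊤ : ℕ∞) => 0
  | (n : ℕ) => Real.exp (x - n)

end

end FermionLattice

section CStar

variable {𝒜 : Type*} [CStarAlgebra 𝒜]

theorem norm_one_add_I_smul_sq_le (K : 𝒜) (hK : IsSelfAdjoint K) (h : ℝ) :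
    ‖1 + (h * Complex.I : ℂ) • K‖ * ‖1 + (h * Complex.I : ℂ) • K‖ ≤ 1 + h ^ 2 * ‖K‖ ^ 2 := by
  rw [← CStarRing.norm_star_mul_self]
  have e : star (1 + (h * Complex.I : ℂ) • K) * (1 + (h * Complex.I : ℂ) • K)
      = 1 + ((h ^ 2 : ℝ) : ℂ) • (K * K) := by
    rw [star_add, star_one, star_smul, hK.star_eq]
    have : star (h * Complex.I : ℂ) = -(h * Complex.I) := by simp
    rw [this, add_mul, mul_add, mul_add, smul_mul_smul_comm]
    have h2 : (-(h * Complex.I) * (h * Complex.I) : ℂ) = ((h ^ 2 : ℝ) : ℂ) := by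
      push_cast
      linear_combination (-(h : ℂ) ^ 2) * Complex.I_sq
    rw [h2]
    simp only [one_mul, mul_one, neg_smul]
    abel
  rw [e]
  rcases subsingleton_or_nontrivial 𝒜 with hs | hn
  · rw [Subsingleton.elim (1 + _ : 𝒜) 0, norm_zero]; positivity
  · calc _ ≤ ‖(1 : 𝒜)‖ + ‖((h ^ 2 : ℝ) : ℂ) • (K * K)‖ := norm_add_le _ _
      _ ≤ 1 + h ^ 2 * ‖K‖ ^ 2 := by
        rw [CStarRing.norm_one, norm_smul, Complex.norm_real, Real.norm_of_nonneg (sq_nonneg h)]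
        have := norm_mul_le K K
        gcongr
        nlinarith

/-- The infinitesimal unitary rotation generated by a self-adjoint element preserves the norm up to
second order. -/
theorem norm_add_commutator_le (K g : 𝒜) (hK : IsSelfAdjoint K) (h : ℝ) :
    ‖g + h • (Complex.I • (K * g - g * K))‖ ≤ ‖g‖ + h ^ 2 * (2 * ‖K‖ ^ 2 * ‖g‖) := by
  set u : 𝒜 := 1 + (h * Complex.I : ℂ) • K with hu
  have hus : star u = 1 - (h * Complex.I : ℂ) • K := by
    rw [hu, star_add, star_one, star_smul, hK.star_eq]
    have : star (h * Complex.I : ℂ) = -(h * Complex.I) := by simp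
    rw [this, neg_smul, sub_eq_add_neg]
  have e : g + h • (Complex.I • (K * g - g * K)) = u * g * star u - ((h ^ 2 : ℝ) : ℂ) • (K * g * K) := by
    have h1 : ∀ x : 𝒜, h • (Complex.I • x) = (h * Complex.I : ℂ) • x := fun x => by
      rw [← Complex.coe_smul, smul_smul]
    have h2 : ((h ^ 2 : ℝ) : ℂ) = -((h * Complex.I) * (h * Complex.I)) := by
      push_cast
      linear_combination ((h : ℂ) ^ 2) * Complex.I_sq
    rw [h1, h2, hus, hu]
    simp only [add_mul, mul_sub, one_mul, mul_one, smul_mul_assoc, mul_smul_comm, neg_smul,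
      smul_sub, smul_smul, smul_add]
    abel
  have h3 : ‖u * g * star u‖ ≤ (1 + h ^ 2 * ‖K‖ ^ 2) * ‖g‖ := by
    calc _ ≤ ‖u‖ * ‖g‖ * ‖star u‖ := norm_mul₃_le
      _ = ‖u‖ * ‖u‖ * ‖g‖ := by rw [norm_star]; ring
      _ ≤ _ := by gcongr; exact norm_one_add_I_smul_sq_le K hK h
  have h4 : ‖((h ^ 2 : ℝ) : ℂ) • (K * g * K)‖ ≤ h ^ 2 * (‖K‖ * ‖g‖ * ‖K‖) := by
    rw [norm_smul, Complex.norm_real, Real.norm_of_nonneg (sq_nonneg h)]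
    gcongr
    exact norm_mul₃_le
  rw [e]
  refine (norm_sub_le _ _).trans ?_
  nlinarith

open Set Filter Topology in
/-- Along a solution of `g' = i [K, g] + R` with self-adjoint `K`, the norm grows at a rate of at
most `‖R‖`. -/
theorem frequently_slope_norm_lt {g : ℝ → 𝒜} {K R : 𝒜} {x : ℝ} (hK : IsSelfAdjoint K)
    (hg : HasDerivAt g (Complex.I • (K * g x - g x * K) + R) x) {r : ℝ} (hr : ‖R‖ < r) :
    ∃ᶠ z in 𝓝[>] x, slope (fun t => ‖g t‖) x z < r := by
  apply Eventually.frequently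
  set ε : ℝ := (r - ‖R‖) / 2 with hε
  have hε0 : 0 < ε := by rw [hε]; linarith
  have h1 := (hg.isLittleO.bound hε0).filter_mono (nhdsWithin_le_nhds (s := Ioi x))
  have h2 : ∀ᶠ z in 𝓝[>] x, (z - x) * (2 * ‖K‖ ^ 2 * ‖g x‖) < ε := by
    have : ContinuousAt (fun z : ℝ => (z - x) * (2 * ‖K‖ ^ 2 * ‖g x‖)) x := by fun_prop
    have := this.eventually_lt (continuousAt_const (y := ε)) (by simpa using hε0)
    exact this.filter_mono nhdsWithin_le_nhds
  filter_upwards [h1, h2, self_mem_nhdsWithin] with z hz1 hz2 hz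
  have hzx : 0 < z - x := sub_pos.2 hz
  set h := z - x
  rw [Real.norm_of_nonneg hzx.le] at hz1
  have h3 := norm_add_commutator_le K (g x) hK h
  have h4 : ‖g z‖ ≤ ‖g x + h • (Complex.I • (K * g x - g x * K))‖ + h * ‖R‖ + ε * h := by
    have e : g z = (g x + h • (Complex.I • (K * g x - g x * K))) + h • R
        + (g z - g x - h • (Complex.I • (K * g x - g x * K) + R)) := by
      rw [smul_add]; abel
    calc ‖g z‖ = _ := congrArg norm e
      _ ≤ _ := norm_add₃_le
      _ ≤ _ := by
        rw [norm_smul h R, Real.norm_of_nonneg hzx.le]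
        gcongr
  rw [slope_def_field, div_lt_iff₀ hzx]
  have : r = ‖R‖ + ε + ε := by rw [hε]; ring
  nlinarith

open Set Filter Topology in
theorem norm_sub_le_of_commutator_flow_off_finite {g : ℝ → 𝒜} {K R : ℝ → 𝒜} {Φ Φ' : ℝ → ℝ}
    (hg : Continuous g) (hΦ : ∀ x, HasDerivAt Φ (Φ' x) x) (n : ℕ) :
    ∀ a b : ℝ, a ≤ b → ∀ F : Finset ℝ, F.card = n →
    (∀ x ∈ Ioo a b, x ∉ F → IsSelfAdjoint (K x) ∧ ‖R x‖ ≤ Φ' x ∧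
      HasDerivAt g (Complex.I • (K x * g x - g x * K x) + R x) x) →
    ‖g b‖ - Φ b ≤ ‖g a‖ - Φ a := by
  have hΦc : Continuous Φ := continuous_iff_continuousAt.2 fun x => (hΦ x).continuousAt
  induction n with
  | zero =>
    intro a b hab F hF h
    rcases hab.eq_or_lt with rfl | hab
    · exact le_rfl
    have key : ∀ c ∈ Ioo a b, ‖g b‖ - Φ b ≤ ‖g c‖ - Φ c := by
      intro c hc
      have := image_le_of_liminf_slope_right_le_deriv_boundary (f := fun t => ‖g t‖) (a := c)
        (b := b) (B := fun t => ‖g c‖ - Φ c + Φ t) (B' := Φ') hg.norm.continuousOn (by simp)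
        (by fun_prop) (fun x _ => ((hΦ x).const_add _).hasDerivWithinAt)
        (fun x hx r hr => by
          obtain ⟨h1, h2, h3⟩ := h x ⟨hc.1.trans_le hx.1, hx.2⟩ (by
            rw [Finset.card_eq_zero.1 hF]; simp)
          exact frequently_slope_norm_lt h1 h3 (h2.trans_lt hr))
        (right_mem_Icc.2 hc.2.le)
      linarith
    have hlim : Tendsto (fun c => ‖g c‖ - Φ c) (𝓝[>] a) (𝓝 (‖g a‖ - Φ a)) :=
      ((hg.norm.sub hΦc).tendsto a).mono_left nhdsWithin_le_nhds
    exact ge_of_tendsto hlim (by filter_upwards [Ioo_mem_nhdsGT hab] with c hc using key c hc)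
  | succ n ih =>
    intro a b hab F hF h
    obtain ⟨c, hc⟩ : F.Nonempty := Finset.card_pos.1 (by omega)
    have hcard : (F.erase c).card = n := by rw [Finset.card_erase_of_mem hc, hF]; rfl
    by_cases hcab : c ∈ Ioo a b
    · refine (ih c b hcab.2.le _ hcard fun x hx hxF => ?_).trans
        (ih a c hcab.1.le _ hcard fun x hx hxF => ?_)
      · exact h x ⟨hcab.1.trans hx.1, hx.2⟩ fun hm => hxF (Finset.mem_erase.2 ⟨hx.1.ne', hm⟩)
      · exact h x ⟨hx.1, hx.2.trans hcab.2⟩ fun hm => hxF (Finset.mem_erase.2 ⟨hx.2.ne, hm⟩)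
    · exact ih a b hab _ hcard fun x hx hxF => h x hx fun hm =>
        hxF (Finset.mem_erase.2 ⟨fun e => hcab (e ▸ hx), hm⟩)

open Set in
/-- Growth estimate for `g' = i [K, g] + R` with self-adjoint `K`, where the equation may fail at
isolated times and `‖R‖` is bounded by a power of the elapsed time, in both time directions. -/
theorem norm_le_add_of_commutator_flow {g : ℝ → 𝒜} {K R : ℝ → 𝒜} {D : Set ℝ} {c s : ℝ} {n : ℕ}
    (hg : Continuous g) (hD : ∀ a b, (D ∩ Icc a b).Finite)
    (h : ∀ x, x ∉ D → IsSelfAdjoint (K x) ∧ ‖R x‖ ≤ c * |x - s| ^ n ∧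
      HasDerivAt g (Complex.I • (K x * g x - g x * K x) + R x) x) (t : ℝ) :
    ‖g t‖ ≤ ‖g s‖ + c * |t - s| ^ (n + 1) / (n + 1) := by
  have hn : ((n : ℝ) + 1) ≠ 0 := by positivity
  rcases le_total s t with hst | hts
  · have hΦ : ∀ x, HasDerivAt (fun x : ℝ => c * (x - s) ^ (n + 1) / (n + 1)) (c * (x - s) ^ n) x := by
      intro x
      have := ((((hasDerivAt_id x).sub_const s).pow (n + 1)).const_mul c).div_const ((n : ℝ) + 1)
      refine this.congr_deriv ?_
      push_cast
      simp only [id]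
      field_simp
    have := norm_sub_le_of_commutator_flow_off_finite (K := K) (R := R) hg hΦ _ s t hst
      (hD s t).toFinset rfl fun x hx hxF => by
        obtain ⟨h1, h2, h3⟩ := h x fun hm => hxF (by simp [hm, hx.1.le, hx.2.le])
        exact ⟨h1, by rwa [abs_of_nonneg (sub_nonneg.2 hx.1.le)] at h2, h3⟩
    rw [abs_of_nonneg (sub_nonneg.2 hst)]
    simp only [sub_self] at this
    rw [zero_pow (Nat.succ_ne_zero n), mul_zero, zero_div] at this
    linarith
  · have hΦ : ∀ x, HasDerivAt (fun x : ℝ => c * (x + s) ^ (n + 1) / (n + 1)) (c * (x + s) ^ n) x := by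
      intro x
      have := ((((hasDerivAt_id x).add_const s).pow (n + 1)).const_mul c).div_const ((n : ℝ) + 1)
      refine this.congr_deriv ?_
      push_cast
      simp only [id]
      field_simp
    have := norm_sub_le_of_commutator_flow_off_finite (g := fun x => g (-x)) (K := fun x => -K (-x))
      (R := fun x => -R (-x)) (by fun_prop) hΦ _ (-s) (-t) (neg_le_neg hts)
      ((hD t s).toFinset.image (fun x => -x)) rfl fun x hx hxF => by
        obtain ⟨h1, h2, h3⟩ := h (-x) fun hm => hxF (by
          simp only [Finset.mem_image, Finite.mem_toFinset]
          exact ⟨-x, ⟨hm, by linarith [hx.2], by linarith [hx.1]⟩, neg_neg x⟩)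
        refine ⟨h1.neg, ?_, ?_⟩
        · rw [norm_neg]
          rwa [← abs_neg, show -(-x - s) = x + s by ring,
            abs_of_nonneg (by linarith [hx.1] : 0 ≤ x + s)] at h2
        · have h4 := h3.scomp x (hasDerivAt_neg x)
          refine h4.congr_deriv ?_
          simp only [neg_smul, one_smul, neg_mul, mul_neg, smul_sub, smul_neg, neg_add]
          abel
    simp only [neg_neg, neg_add_cancel] at this
    rw [zero_pow (Nat.succ_ne_zero n), mul_zero, zero_div] at this
    rw [← abs_neg, show -(t - s) = -t + s by ring, abs_of_nonneg (by linarith : 0 ≤ -t + s)]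
    linarith

end CStar

namespace FermionLattice

theorem star_anticommute {R : Type*} [Ring R] [StarRing R] {a b : R}
    (h : a * b + b * a = 0) : star a * star b + star b * star a = 0 := by
  rw [← star_mul, ← star_mul, ← star_add, add_comm, h, star_zero]

theorem prod_mul_of_anticommute {R : Type*} [Ring R] (l : List R) (b : R)
    (h : ∀ a ∈ l, a * b = -(b * a)) : l.prod * b = (-1) ^ l.length * (b * l.prod) := by
  induction l with
  | nil => simp
  | cons a l ih =>
    have h1 := ih fun a ha => h a (List.mem_cons_of_mem _ ha)
    rw [List.prod_cons, List.length_cons, mul_assoc, h1, ← mul_assoc,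
      ((Commute.neg_one_right a).pow_right l.length).eq, mul_assoc, ← mul_assoc a b,
      h a List.mem_cons_self, pow_succ]
    noncomm_ring

theorem commute_prod_of_anticommute_of_even {R : Type*} [Ring R] {l : List R} {b : R}
    (h : ∀ a ∈ l, a * b = -(b * a)) (hl : Even l.length) : Commute l.prod b := by
  have := prod_mul_of_anticommute l b h
  rwa [hl.neg_one_pow, one_mul] at this

section Algebra

variable {V : Type*} [Fintype V] [LinearOrder V]

theorem generators_anticommute {X Y : Finset V} (hXY : Disjoint X Y) {a b : Op V}
    (ha : a ∈ generators X) (hb : b ∈ generators Y) : a * b = -(b * a) := by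
  obtain ⟨j, hj, ha⟩ := ha
  obtain ⟨k, hk, hb⟩ := hb
  have hjk : j ≠ k := fun e => Finset.disjoint_left.1 hXY hj (e ▸ hk)
  rw [eq_neg_iff_add_eq_zero]
  rcases ha with rfl | rfl <;> rcases hb with rfl | rfl
  · exact anticomm_annihilation j k
  · rw [anticomm_annihilation_creation, if_neg hjk]
  · rw [add_comm, anticomm_annihilation_creation, if_neg hjk.symm]
  · have := star_anticommute (anticomm_annihilation j k)
    exact this

theorem commute_of_mem_evenAlgebra {X Y : Finset V} (hXY : Disjoint X Y) {A B : Op V}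
    (hA : A ∈ evenAlgebra X) (hB : B ∈ evenAlgebra Y) : Commute A B := by
  induction hA using Submodule.span_induction with
  | zero => exact Commute.zero_left B
  | add A A' _ _ h h' => exact h.add_left h'
  | smul c A _ h => exact h.smul_left c
  | mem A hA =>
    obtain ⟨l, hl, hle, rfl⟩ := hA
    induction hB using Submodule.span_induction with
    | zero => exact Commute.zero_right _
    | add B B' _ _ h h' => exact h.add_right h'
    | smul c B _ h => exact h.smul_right c
    | mem B hB =>
      obtain ⟨m, hm, -, rfl⟩ := hB
      refine Commute.list_prod_right _ _ fun b hb => ?_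
      exact commute_prod_of_anticommute_of_even
        (fun a ha => generators_anticommute hXY (hl a ha) (hm b hb)) hle

theorem liouvillian_apply (K A : Op V) :
    liouvillian K A = Complex.I • (K * A - A * K) := rfl

theorem norm_liouvillian_le (K : Op V) : ‖liouvillian K‖ ≤ 2 * ‖K‖ := by
  refine ContinuousLinearMap.opNorm_le_bound _ (by positivity) fun A => ?_
  rw [liouvillian_apply, norm_smul, Complex.norm_I, one_mul]
  have h1 := norm_sub_le (K * A) (A * K)
  have h2 := norm_mul_le K A
  have h3 := norm_mul_le A K
  linarith

theorem norm_commutator_le (A B : Op V) : ‖A * B - B * A‖ ≤ 2 * ‖A‖ * ‖B‖ := by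
  have h1 := norm_sub_le (A * B) (B * A)
  have h2 := norm_mul_le A B
  have h3 := norm_mul_le B A
  linarith

/-- The difference of two eigenvalues of `K` is an eigenvalue of its Liouvillian. -/
theorem sub_le_norm_liouvillian {K : Op V} (hK : IsSelfAdjoint K) {u w : Fock V} {α β : ℝ}
    (hu : ‖u‖ = 1) (hw : ‖w‖ = 1) (hKu : K u = (α : ℂ) • u) (hKw : K w = (β : ℂ) • w) :
    α - β ≤ ‖liouvillian K‖ := by
  set P : Op V := InnerProductSpace.rankOne ℂ u w
  have hP : ‖P‖ = 1 := by simp [P, hu, hw]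
  have e : liouvillian K P = (Complex.I * ((α - β : ℝ) : ℂ)) • P := by
    rw [liouvillian_apply, mul_smul]
    congr 1
    ext1 x
    have hs : inner ℂ w (K x) = (β : ℂ) * inner ℂ w x := by
      have := hK.isSymmetric w x
      simp only [ContinuousLinearMap.coe_coe] at this
      rw [← this, hKw, inner_smul_left, Complex.conj_ofReal]
    change K (inner ℂ w x • u) - inner ℂ w (K x) • u = ((α - β : ℝ) : ℂ) • (inner ℂ w x • u)
    rw [map_smul, hKu, hs, smul_smul, smul_smul, ← sub_smul]
    congr 1
    push_cast
    ring
  have h1 := (liouvillian K).le_opNorm P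
  rw [e, norm_smul, hP, norm_mul, Complex.norm_I, Complex.norm_real] at h1
  have := le_abs_self (α - β)
  rw [Real.norm_eq_abs] at h1
  linarith

/-- A Hermitian operator is within half the norm of its Liouvillian of a scalar. -/
theorem exists_norm_sub_smul_one_le {K : Op V} (hK : IsSelfAdjoint K) :
    ∃ c : ℂ, ‖K - c • (1 : Op V)‖ ≤ ‖liouvillian K‖ / 2 := by
  set hn : Module.finrank ℂ (Fock V) = Module.finrank ℂ (Fock V) := rfl
  have hS := hK.isSymmetric
  set e := hS.eigenvectorBasis hn
  set lam := hS.eigenvalues hn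
  have hKe : ∀ i, K (e i) = (lam i : ℂ) • e i := hS.apply_eigenvectorBasis hn
  have : Nonempty (Fin (Module.finrank ℂ (Fock V))) :=
    ⟨⟨0, Module.finrank_pos⟩⟩
  obtain ⟨p, hp⟩ := Finite.exists_max lam
  obtain ⟨q, hq⟩ := Finite.exists_min lam
  have hgap := sub_le_norm_liouvillian hK (e.norm_eq_one p) (e.norm_eq_one q) (hKe p) (hKe q)
  refine ⟨(((lam p + lam q) / 2 : ℝ) : ℂ), ContinuousLinearMap.opNorm_le_bound _ (by positivity)
    fun x => ?_⟩
  refine le_of_sq_le_sq ?_ (by positivity)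
  rw [mul_pow, ← e.sum_sq_norm_inner_right, ← e.sum_sq_norm_inner_right, Finset.mul_sum]
  refine Finset.sum_le_sum fun i _ => ?_
  have hi : inner ℂ (e i) ((K - (((lam p + lam q) / 2 : ℝ) : ℂ) • (1 : Op V)) x)
      = ((lam i - (lam p + lam q) / 2 : ℝ) : ℂ) * inner ℂ (e i) x := by
    have := hS (e i) x
    simp only [ContinuousLinearMap.coe_coe] at this
    change inner ℂ (e i) (K x - (((lam p + lam q) / 2 : ℝ) : ℂ) • x) = _
    rw [inner_sub_right, ← this, hKe, inner_smul_left, inner_smul_right, Complex.conj_ofReal,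
      ← sub_mul, ← Complex.ofReal_sub]
  rw [hi, norm_mul, mul_pow, Complex.norm_real, Real.norm_eq_abs, sq_abs]
  gcongr ?_ * _
  have h1 := hp i
  have h2 := hq i
  exact sq_le_sq' (by linarith) (by linarith)

end Algebra

section Graph

variable {V : Type*} [DecidableEq V]

theorem IsPath.reverse {E : Finset (Finset V)} {X Y : Finset V} {l : List (Finset V)}
    (h : IsPath E X Y l) : IsPath E Y X l.reverse := by
  obtain ⟨h1, h2, h3, h4⟩ := h
  refine ⟨fun e he => h1 e (List.mem_reverse.1 he), ?_, ?_, ?_⟩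
  · rw [List.isChain_reverse]
    exact h2.imp fun a b hab => by rwa [Finset.inter_comm]
  · rwa [List.head?_reverse]
  · rwa [List.getLast?_reverse]

theorem graphDist_comm (E : Finset (Finset V)) (X Y : Finset V) :
    graphDist E X Y = graphDist E Y X := by
  unfold graphDist
  rw [Finset.inter_comm]
  congr 2
  ext n
  constructor <;> rintro ⟨l, hl, rfl⟩ <;> exact ⟨l.reverse, hl.reverse, by simp⟩

theorem graphDist_eq_zero_of_inter_nonempty {E : Finset (Finset V)} {X Y : Finset V}
    (h : (X ∩ Y).Nonempty) : graphDist E X Y = 0 := if_pos h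

theorem disjoint_of_pos_graphDist {E : Finset (Finset V)} {X Y : Finset V}
    (h : 0 < graphDist E X Y) : Disjoint X Y := by
  rw [Finset.disjoint_iff_inter_eq_empty, ← Finset.not_nonempty_iff_eq_empty]
  exact fun hne => h.ne' (graphDist_eq_zero_of_inter_nonempty hne)

/-- Passing to a hyperedge that meets `X` decreases the distance by at most one. -/
theorem graphDist_le_graphDist_add_one {E : Finset (Finset V)} {X Y Z : Finset V} (hZ : Z ∈ E)
    (hZX : (Z ∩ X).Nonempty) : graphDist E X Y ≤ graphDist E Z Y + 1 := by
  by_cases hXY : (X ∩ Y).Nonempty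
  · rw [graphDist_eq_zero_of_inter_nonempty hXY]
    exact zero_le
  by_cases hZY : (Z ∩ Y).Nonempty
  · rw [graphDist_eq_zero_of_inter_nonempty hZY, graphDist, if_neg hXY]
    refine sInf_le ⟨[Z], ⟨by simpa using hZ, by simp, ⟨Z, by simp, hZX⟩, ⟨Z, by simp, hZY⟩⟩, ?_⟩
    simp
  by_cases hne : {n : ℕ∞ | ∃ l, IsPath E Z Y l ∧ n = l.length}.Nonempty
  · obtain ⟨l, ⟨h1, h2, ⟨e, he, heZ⟩, ⟨e', he', heY⟩⟩, hl⟩ := csInf_mem hne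
    have hd : graphDist E Z Y = l.length := by rw [graphDist, if_neg hZY, hl]
    rw [hd, graphDist, if_neg hXY]
    refine sInf_le ⟨Z :: l, ⟨?_, ?_, ⟨Z, by simp, hZX⟩, ⟨e', ?_, heY⟩⟩, by simp⟩
    · simpa using ⟨hZ, h1⟩
    · rw [List.isChain_cons]
      refine ⟨fun y hy => ?_, h2⟩
      obtain rfl := Option.mem_unique he hy
      rwa [Finset.inter_comm]
    · rw [List.getLast?_cons, Option.mem_def.1 he']
      simp
  · have : graphDist E Z Y = ⊤ := by
      rw [graphDist, if_neg hZY, Set.not_nonempty_iff_eq_empty.1 hne, sInf_empty]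
    rw [this]
    simp

theorem card_filter_inter_nonempty_le_maxNeighbors {E : Finset (Finset V)} {X : Finset V}
    (hX : X ∈ E) : (E.filter (fun Y => (Y ∩ X).Nonempty)).card ≤ maxNeighbors E :=
  Finset.le_sup (f := fun X => (E.filter (fun Y => (Y ∩ X).Nonempty)).card) hX

theorem card_filter_inter_nonempty_le_card_mul (E : Finset (Finset V)) (X : Finset V) :
    (E.filter (fun Y => (Y ∩ X).Nonempty)).card ≤ X.card * maxNeighbors E := by
  have hsub : E.filter (fun Y => (Y ∩ X).Nonempty) ⊆ X.biUnion fun x => E.filter (x ∈ ·) := by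
    intro Y hY
    obtain ⟨hYE, x, hx⟩ := Finset.mem_filter.1 hY
    rw [Finset.mem_inter] at hx
    exact Finset.mem_biUnion.2 ⟨x, hx.2, Finset.mem_filter.2 ⟨hYE, hx.1⟩⟩
  refine (Finset.card_le_card hsub).trans (Finset.card_biUnion_le_card_mul _ _ _ fun x _ => ?_)
  rcases (E.filter (x ∈ ·)).eq_empty_or_nonempty with h | ⟨Z, hZ⟩
  · simp [h]
  obtain ⟨hZE, hxZ⟩ := Finset.mem_filter.1 hZ
  refine (Finset.card_le_card fun Y hY => ?_).trans (card_filter_inter_nonempty_le_maxNeighbors hZE)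
  obtain ⟨hYE, hxY⟩ := Finset.mem_filter.1 hY
  exact Finset.mem_filter.2 ⟨hYE, x, Finset.mem_inter.2 ⟨hxY, hxZ⟩⟩

end Graph

end FermionLattice

theorem lieb_robinson_prefactor_succ (k m l β α y : ℝ) (n : ℕ) :
    k * m * (l * (2 * β * ((m * l) ^ n / n.factorial)) * α) * y / (n + 1)
      = 2 * k * β * α * ((m * l) ^ (n + 1) / (n + 1).factorial) * y := by
  rw [Nat.factorial_succ, pow_succ]
  push_cast
  field_simp

section CommutatorIdentities

variable {R : Type*} [Ring R] [Algebra ℂ R]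

theorem neg_smul_commutator (c : ℂ) (K g : R) :
    -(c • (K * g - g * K)) = c • (-K * g - g * -K) + 0 := by
  rw [add_zero, neg_mul, mul_neg, ← smul_neg]
  congr 1
  abel

theorem commutator_leibniz (c : ℂ) (K x y : R) :
    -(c • (K * x - x * K)) * y + x * -(c • (K * y - y * K))
      - (-(c • (K * y - y * K)) * x + y * -(c • (K * x - x * K)))
      = -(c • (K * (x * y - y * x) - (x * y - y * x) * K)) := by
  simp only [neg_mul, mul_neg, smul_mul_assoc, mul_smul_comm]
  simp only [← smul_neg, ← smul_add, ← smul_sub]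
  congr 1
  noncomm_ring

theorem commutator_jacobi (c : ℂ) {K A : R} (h : Commute K A) (L w : R) :
    A * -(c • ((L + K) * w - w * (L + K))) - -(c • ((L + K) * w - w * (L + K))) * A
      = c • (-K * (A * w - w * A) - (A * w - w * A) * -K)
        + -(c • (A * (L * w - w * L) - (L * w - w * L) * A)) := by
  have e1 : K * (A * w) = A * K * w := by rw [← mul_assoc, h.eq]
  have e2 : w * A * K = w * (K * A) := by rw [mul_assoc, h.eq]
  simp only [neg_mul, mul_neg, smul_mul_assoc, mul_smul_comm]
  simp only [← smul_neg, ← smul_add, ← smul_sub]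
  congr 1
  simp only [mul_sub, sub_mul, mul_add, add_mul, e1, e2]
  simp only [mul_assoc]
  abel

end CommutatorIdentities

namespace FermionLattice

section Graph

theorem inter_nonempty_of_graphDist_eq_zero {V : Type*} [DecidableEq V] {E : Finset (Finset V)} {X Y : Finset V} (h : graphDist E X Y = 0) :
    (X ∩ Y).Nonempty := by
  by_contra hXY
  rw [graphDist, if_neg hXY] at h
  have hne : {n : ℕ∞ | ∃ l, IsPath E X Y l ∧ n = l.length}.Nonempty := by
    rw [Set.nonempty_iff_ne_empty]
    intro h'
    simp [h'] at h
  obtain ⟨l, ⟨-, -, ⟨e, he, -⟩, -⟩, hl⟩ := csInf_mem hne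
  rw [h] at hl
  have : l = [] := List.length_eq_zero_iff.1 (by exact_mod_cast hl.symm)
  simp [this] at he

end Graph

section Dynamics

variable {V : Type*} [Fintype V] [LinearOrder V] {E : Finset (Finset V)}
  {H : Finset V → ℝ → Op V} {b : ℝ} {τ : ℝ → ℝ → Op V →L[ℂ] Op V}

theorem liouvillianBound_nonneg (E : Finset (Finset V)) (H : Finset V → ℝ → Op V) :
    0 ≤ liouvillianBound E H := Real.iSup_nonneg fun q => norm_nonneg (liouvillian (H q.1 q.2))

theorem norm_liouvillian_le_liouvillianBound (hb : ∀ X ∈ E, ∀ r, ‖H X r‖ ≤ b) {X : Finset V}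
    (hX : X ∈ E) (r : ℝ) : ‖liouvillian (H X r)‖ ≤ liouvillianBound E H := by
  have hbdd : BddAbove (Set.range fun q : E × ℝ => ‖liouvillian (H q.1 q.2)‖) := by
    refine ⟨2 * b, ?_⟩
    rintro _ ⟨q, rfl⟩
    exact (norm_liouvillian_le _).trans (by linarith [hb q.1 q.1.2 q.2])
  exact le_ciSup hbdd (⟨⟨X, hX⟩, r⟩ : E × ℝ)

theorem liebRobinsonSpeed_le (hb : ∀ X ∈ E, ∀ r, ‖H X r‖ ≤ b) :
    liebRobinsonSpeed E H ≤ 2 * Real.exp 1 * b * maxNeighbors E := by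
  rcases E.eq_empty_or_nonempty with rfl | ⟨X, hX⟩
  · simp [liebRobinsonSpeed, maxNeighbors]
  · have : Nonempty (E × ℝ) := ⟨⟨X, hX⟩, 0⟩
    have h1 : liouvillianBound E H ≤ 2 * b := ciSup_le fun q =>
      (norm_liouvillian_le _).trans (by linarith [hb q.1 q.1.2 q.2])
    calc _ ≤ Real.exp 1 * (2 * b) * maxNeighbors E := by
          unfold liebRobinsonSpeed
          gcongr
      _ = _ := by ring

/-- The times at which some term of the Hamiltonian is discontinuous. -/
def discontinuityTimes (E : Finset (Finset V)) (H : Finset V → ℝ → Op V) : Set ℝ :=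
  {r | ∃ X ∈ E, ¬ ContinuousAt (H X) r}

theorem finite_discontinuityTimes_inter_Icc (hH : IsLocalHamiltonian E H) (a b : ℝ) :
    (discontinuityTimes E H ∩ Set.Icc a b).Finite := by
  refine (E.finite_toSet.biUnion fun X hX => (hH.piecewiseContinuous X hX).1 a b).subset ?_
  rintro r ⟨⟨X, hX, hr⟩, hab⟩
  exact Set.mem_biUnion hX ⟨hab, hr⟩

theorem continuousAt_totalHamiltonian {r : ℝ} (hr : r ∉ discontinuityTimes E H) :
    ContinuousAt (totalHamiltonian E H) r := by
  unfold totalHamiltonian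
  refine tendsto_finsetSum _ fun X hX => ?_
  by_contra h
  exact hr ⟨X, hX, h⟩

theorem isSelfAdjoint_sum_of_subset (hH : IsLocalHamiltonian E H) {S : Finset (Finset V)}
    (hS : S ⊆ E) (r : ℝ) : IsSelfAdjoint (∑ X ∈ S, H X r) := by
  have := isSelfAdjoint_sum (R := Op V) S (x := fun X => H X r) fun X hX =>
    hH.isSelfAdjoint X (hS hX) r
  exact this

theorem hasDerivAt_propagator (hτ : IsPropagator (totalHamiltonian E H) τ) (t : ℝ) (A : Op V)
    {r : ℝ} (hr : r ∉ discontinuityTimes E H) :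
    HasDerivAt (fun s => τ s t A) (-(Complex.I • (totalHamiltonian E H r * τ r t A
      - τ r t A * totalHamiltonian E H r))) r :=
  hτ.hasDerivAt t A r (continuousAt_totalHamiltonian hr)

/-- A solution of the Heisenberg equation does not increase in norm. -/
theorem norm_le_of_heisenberg (hH : IsLocalHamiltonian E H) {g : ℝ → Op V} (hg : Continuous g)
    (hd : ∀ r, r ∉ discontinuityTimes E H → HasDerivAt g
      (-(Complex.I • (totalHamiltonian E H r * g r - g r * totalHamiltonian E H r))) r)
    (s t : ℝ) : ‖g t‖ ≤ ‖g s‖ := by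
  have := norm_le_add_of_commutator_flow (K := fun r => -totalHamiltonian E H r) (R := fun _ => 0)
    (c := 0) (s := s) (n := 0) hg (finite_discontinuityTimes_inter_Icc hH) (fun r hr => by
      refine ⟨(isSelfAdjoint_sum_of_subset hH subset_rfl r).neg, by simp, ?_⟩
      exact (hd r hr).congr_deriv (neg_smul_commutator _ _ _)) t
  simpa using this

theorem norm_propagator_le (hH : IsLocalHamiltonian E H)
    (hτ : IsPropagator (totalHamiltonian E H) τ) (s t : ℝ) (A : Op V) : ‖τ s t A‖ ≤ ‖A‖ := by
  have := norm_le_of_heisenberg hH (hτ.continuous t A) (fun r hr => hasDerivAt_propagator hτ t A hr)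
    t s
  simpa [hτ.self t] using this

/-- The commutator of two solutions of the Heisenberg equation has constant norm. -/
theorem norm_commutator_propagator_le (hH : IsLocalHamiltonian E H)
    (hτ : IsPropagator (totalHamiltonian E H) τ) (s t : ℝ) (A B : Op V) :
    ‖B * τ s t A - τ s t A * B‖ ≤ ‖A * τ t s B - τ t s B * A‖ := by
  have hc : Continuous fun r => τ r s B * τ r t A - τ r t A * τ r s B := by
    have h1 := hτ.continuous s B
    have h2 := hτ.continuous t A
    exact (h1.mul h2).sub (h2.mul h1)
  have := norm_le_of_heisenberg hH hc (fun r hr => by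
    have h1 := hasDerivAt_propagator hτ s B hr
    have h2 := hasDerivAt_propagator hτ t A hr
    exact ((h1.mul h2).sub (h2.mul h1)).congr_deriv (commutator_leibniz _ _ _ _)) t s
  simp only [hτ.self, ContinuousLinearMap.id_apply] at this
  rwa [norm_sub_rev (τ t s B * A)] at this

theorem one_mem_evenAlgebra (X : Finset V) : (1 : Op V) ∈ evenAlgebra X :=
  Submodule.subset_span ⟨[], by simp, by simp, by simp⟩

/-- If `W` almost commutes with all even operators of the region `Z`, relative to their norm, then
its commutator with a Hermitian one is bounded in terms of the Liouvillian of the latter. -/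
theorem norm_commutator_le_norm_liouvillian_mul {Z : Finset V} {K W : Op V} {c : ℝ} (hc : 0 ≤ c)
    (hK : IsSelfAdjoint K) (hKZ : K ∈ evenAlgebra Z)
    (h : ∀ C ∈ evenAlgebra Z, ‖C * W - W * C‖ ≤ c * ‖C‖) :
    ‖K * W - W * K‖ ≤ c * (‖liouvillian K‖ / 2) := by
  obtain ⟨z, hz⟩ := exists_norm_sub_smul_one_le hK
  have e : K * W - W * K = (K - z • (1 : Op V)) * W - W * (K - z • (1 : Op V)) := by
    rw [sub_mul, mul_sub, smul_mul_assoc, mul_smul_comm, one_mul, mul_one]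
    abel
  rw [e]
  refine (h _ (sub_mem hKZ (Submodule.smul_mem _ z (one_mem_evenAlgebra Z)))).trans ?_
  gcongr

/-- One iteration of the Lieb-Robinson argument: if the commutators of `τ t s B` with operators of
the hyperedges meeting `X` are small, then so are those with operators of `X`. -/
theorem norm_commutator_propagator_step (hH : IsLocalHamiltonian E H)
    (hb : ∀ X ∈ E, ∀ r, ‖H X r‖ ≤ b) (hτ : IsPropagator (totalHamiltonian E H) τ)
    {X : Finset V} {A B : Op V} {s c : ℝ} {n : ℕ} (hc0 : 0 ≤ c) (hA : A ∈ evenAlgebra X)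
    (hAB : Commute A B)
    (hc : ∀ Z ∈ E, (Z ∩ X).Nonempty → ∀ C ∈ evenAlgebra Z, ∀ t,
      ‖C * τ t s B - τ t s B * C‖ ≤ c * |t - s| ^ n * ‖C‖) (t : ℝ) :
    ‖A * τ t s B - τ t s B * A‖ ≤ (E.filter (fun Z => (Z ∩ X).Nonempty)).card *
      (liouvillianBound E H * c * ‖A‖) * |t - s| ^ (n + 1) / (n + 1) := by
  set S := E.filter (fun Z => (Z ∩ X).Nonempty) with hS
  set S' := E.filter (fun Z => ¬ (Z ∩ X).Nonempty) with hS'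
  have hsplit : ∀ r, totalHamiltonian E H r = (∑ Z ∈ S, H Z r) + ∑ Z ∈ S', H Z r := fun r =>
    (Finset.sum_filter_add_sum_filter_not E _ _).symm
  have hcomm : ∀ r, Commute (∑ Z ∈ S', H Z r) A := fun r => by
    refine Commute.sum_left _ _ _ fun Z hZ => ?_
    obtain ⟨hZE, hZX⟩ := Finset.mem_filter.1 hZ
    refine commute_of_mem_evenAlgebra ?_ (hH.mem_even Z hZE r) hA
    rwa [Finset.disjoint_iff_inter_eq_empty, ← Finset.not_nonempty_iff_eq_empty]
  set W : ℝ → Op V := fun r => τ r s B with hW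
  set R : ℝ → Op V := fun r => -(Complex.I • (A * ((∑ Z ∈ S, H Z r) * W r - W r * ∑ Z ∈ S, H Z r)
    - ((∑ Z ∈ S, H Z r) * W r - W r * ∑ Z ∈ S, H Z r) * A)) with hR
  have hWc : Continuous W := hτ.continuous s B
  have hRle : ∀ r, ‖R r‖ ≤ S.card * (liouvillianBound E H * c * ‖A‖) * |r - s| ^ n := by
    intro r
    rw [hR, norm_neg, norm_smul, Complex.norm_I, one_mul]
    refine (norm_commutator_le _ _).trans ?_
    have h1 : ‖(∑ Z ∈ S, H Z r) * W r - W r * ∑ Z ∈ S, H Z r‖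
        ≤ S.card • (c * |r - s| ^ n * (liouvillianBound E H / 2)) := by
      rw [Finset.sum_mul, Finset.mul_sum, ← Finset.sum_sub_distrib]
      refine (norm_sum_le _ _).trans (Finset.sum_le_card_nsmul _ _ _ fun Z hZ => ?_)
      obtain ⟨hZE, hZX⟩ := Finset.mem_filter.1 hZ
      refine (norm_commutator_le_norm_liouvillian_mul (by positivity) (hH.isSelfAdjoint Z hZE r)
        (hH.mem_even Z hZE r) fun C hC => hc Z hZE hZX C hC r).trans ?_
      have := norm_liouvillian_le_liouvillianBound hb hZE r
      gcongr
    rw [nsmul_eq_mul] at h1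
    calc _ ≤ 2 * ‖A‖ * (S.card * (c * |r - s| ^ n * (liouvillianBound E H / 2))) := by gcongr
      _ = _ := by ring
  have := norm_le_add_of_commutator_flow (g := fun r => A * W r - W r * A)
    (K := fun r => -∑ Z ∈ S', H Z r) (R := R) (s := s)
    ((continuous_const.mul hWc).sub (hWc.mul continuous_const)) (finite_discontinuityTimes_inter_Icc hH) (fun r hr => by
      refine ⟨(isSelfAdjoint_sum_of_subset hH (Finset.filter_subset _ _) r).neg, hRle r, ?_⟩
      have h1 := hasDerivAt_propagator hτ s B hr
      rw [hsplit] at h1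
      exact ((h1.const_mul A).sub (h1.mul_const A)).congr_deriv
        (commutator_jacobi _ (hcomm r) _ _)) t
  have h0 : A * W s - W s * A = 0 := by
    simp only [hW, hτ.self, ContinuousLinearMap.id_apply]
    exact sub_eq_zero.2 hAB.eq
  simpa only [h0, norm_zero, zero_add] using this

theorem norm_commutator_propagator_le_of_hyperedge (hH : IsLocalHamiltonian E H)
    (hb : ∀ X ∈ E, ∀ r, ‖H X r‖ ≤ b) (hτ : IsPropagator (totalHamiltonian E H) τ)
    {Y : Finset V} {B : Op V} (hB : B ∈ evenAlgebra Y) (s : ℝ) (n : ℕ) :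
    ∀ Z ∈ E, (n : ℕ∞) ≤ graphDist E Z Y → ∀ C ∈ evenAlgebra Z, ∀ t,
      ‖C * τ t s B - τ t s B * C‖ ≤
        2 * ‖B‖ * ((maxNeighbors E * liouvillianBound E H) ^ n / n.factorial) * |t - s| ^ n * ‖C‖ := by
  have hl := liouvillianBound_nonneg E H
  induction n with
  | zero =>
    intro Z _ _ C _ t
    refine (norm_commutator_le _ _).trans ?_
    have := norm_propagator_le hH hτ t s B
    simp only [pow_zero, Nat.factorial_zero, Nat.cast_one, div_one, mul_one]
    nlinarith [norm_nonneg C]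
  | succ n ih =>
    intro Z hZ hd C hC t
    push_cast at hd
    have hdisj : Disjoint Z Y := disjoint_of_pos_graphDist (lt_of_lt_of_le (by simp) hd)
    refine (norm_commutator_propagator_step hH hb hτ
      (c := 2 * ‖B‖ * ((maxNeighbors E * liouvillianBound E H) ^ n / n.factorial)) (n := n)
      (by positivity) hC (commute_of_mem_evenAlgebra hdisj hC hB) (fun Z' hZ' hne C' hC' t' => ?_)
      t).trans ?_
    · refine ih Z' hZ' ?_ C' hC' t'
      exact (ENat.add_le_add_iff_right ENat.one_ne_top).1
        (hd.trans (graphDist_le_graphDist_add_one hZ' hne))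
    · have hN : (((E.filter (fun Y => (Y ∩ Z).Nonempty)).card : ℕ) : ℝ) ≤ maxNeighbors E := by
        exact_mod_cast card_filter_inter_nonempty_le_maxNeighbors hZ
      calc _ ≤ maxNeighbors E * (liouvillianBound E H * (2 * ‖B‖ *
            ((maxNeighbors E * liouvillianBound E H) ^ n / n.factorial)) * ‖C‖) *
              |t - s| ^ (n + 1) / (n + 1) := by gcongr
        _ = 1 * maxNeighbors E * (liouvillianBound E H * (2 * ‖B‖ *
            ((maxNeighbors E * liouvillianBound E H) ^ n / n.factorial)) * ‖C‖) *
              |t - s| ^ (n + 1) / (n + 1) := by rw [one_mul]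
        _ = _ := by
          rw [lieb_robinson_prefactor_succ]
          ring

theorem norm_commutator_propagator_le_pow (hH : IsLocalHamiltonian E H)
    (hb : ∀ X ∈ E, ∀ r, ‖H X r‖ ≤ b) (hτ : IsPropagator (totalHamiltonian E H) τ)
    {X Y : Finset V} {A B : Op V} (hA : A ∈ evenAlgebra X) (hB : B ∈ evenAlgebra Y) (s t : ℝ)
    {n : ℕ} (hn : ((n + 1 : ℕ) : ℕ∞) ≤ graphDist E X Y) :
    ‖A * τ t s B - τ t s B * A‖ ≤ 2 * X.card * ‖B‖ * ‖A‖ *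
      ((maxNeighbors E * liouvillianBound E H * |t - s|) ^ (n + 1) / (n + 1).factorial) := by
  have hl := liouvillianBound_nonneg E H
  push_cast at hn
  have hdisj : Disjoint X Y := disjoint_of_pos_graphDist (lt_of_lt_of_le (by simp) hn)
  refine (norm_commutator_propagator_step hH hb hτ
    (c := 2 * ‖B‖ * ((maxNeighbors E * liouvillianBound E H) ^ n / n.factorial)) (n := n)
    (by positivity) hA (commute_of_mem_evenAlgebra hdisj hA hB) (fun Z hZ hne C hC t' => ?_)
    t).trans ?_
  · refine norm_commutator_propagator_le_of_hyperedge hH hb hτ hB s n Z hZ ?_ C hC t'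
    exact (ENat.add_le_add_iff_right ENat.one_ne_top).1
      (hn.trans (graphDist_le_graphDist_add_one hZ hne))
  · have hN : (((E.filter (fun Y => (Y ∩ X).Nonempty)).card : ℕ) : ℝ)
        ≤ X.card * maxNeighbors E := by
      exact_mod_cast card_filter_inter_nonempty_le_card_mul E X
    calc _ ≤ (X.card * maxNeighbors E) * (liouvillianBound E H * (2 * ‖B‖ *
          ((maxNeighbors E * liouvillianBound E H) ^ n / n.factorial)) * ‖A‖) *
            |t - s| ^ (n + 1) / (n + 1) := by gcongr
      _ = _ := by
        rw [lieb_robinson_prefactor_succ, mul_pow _ |t - s|]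
        ring

theorem pow_div_factorial_le_exp_sub {w : ℝ} (hw : 0 ≤ w) (n : ℕ) :
    w ^ n / n.factorial ≤ Real.exp (Real.exp 1 * w - n) := by
  have h := Real.pow_div_factorial_le_exp (Real.exp 1 * w) (by positivity) n
  rw [Real.exp_sub, le_div_iff₀ (Real.exp_pos _)]
  refine le_trans (le_of_eq ?_) h
  rw [mul_pow, ← Real.exp_nat_mul, mul_one]
  ring

/-- The Lieb-Robinson bound with a prefactor depending on the support of the operator that does not
evolve. -/
theorem norm_commutator_propagator_le_expSub (hH : IsLocalHamiltonian E H)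
    (hb : ∀ X ∈ E, ∀ r, ‖H X r‖ ≤ b) (hτ : IsPropagator (totalHamiltonian E H) τ)
    {X Y : Finset V} {A B : Op V} (hA : A ∈ evenAlgebra X) (hB : B ∈ evenAlgebra Y) (s t : ℝ) :
    ‖A * τ t s B - τ t s B * A‖ ≤ 2 * X.card * ‖B‖ * ‖A‖ *
      expSub (liebRobinsonSpeed E H * |t - s|) (graphDist E X Y) := by
  have hl := liouvillianBound_nonneg E H
  have hpow := fun n => norm_commutator_propagator_le_pow (n := n) hH hb hτ hA hB s t
  set w : ℝ := maxNeighbors E * liouvillianBound E H * |t - s| with hw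
  have hw0 : 0 ≤ w := by positivity
  have hv : liebRobinsonSpeed E H * |t - s| = Real.exp 1 * w := by
    rw [hw, liebRobinsonSpeed]; ring
  rw [hv]
  cases hd : graphDist E X Y with
  | top =>
    have hlim := ((FloorSemiring.tendsto_pow_div_factorial_atTop w).const_mul
      (2 * X.card * ‖B‖ * ‖A‖)).comp (Filter.tendsto_add_atTop_nat 1)
    exact ge_of_tendsto' hlim fun n => hpow n (by rw [hd]; exact le_top)
  | coe n =>
    change _ ≤ _ * Real.exp (Real.exp 1 * w - n)
    cases n with
    | zero =>
      obtain ⟨x, hx⟩ := inter_nonempty_of_graphDist_eq_zero hd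
      have hX : (1 : ℝ) ≤ X.card := by
        exact_mod_cast Finset.card_pos.2 ⟨x, (Finset.mem_inter.1 hx).1⟩
      have hexp : 1 ≤ Real.exp (Real.exp 1 * w - (0 : ℕ)) := by
        rw [Nat.cast_zero, sub_zero]
        exact Real.one_le_exp (by positivity)
      calc _ ≤ 2 * ‖A‖ * ‖τ t s B‖ := norm_commutator_le _ _
        _ ≤ 2 * ‖A‖ * ‖B‖ := by gcongr; exact norm_propagator_le hH hτ t s B
        _ = 2 * 1 * ‖B‖ * ‖A‖ * 1 := by ring
        _ ≤ _ := by gcongr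
    | succ n =>
      refine (hpow n hd.ge).trans ?_
      gcongr
      exact pow_div_factorial_le_exp_sub hw0 (n + 1)

end Dynamics

end FermionLattice

theorem mainTheorem1 :
    ∃ p : Polynomial ℝ, ∀ (V : Type*) [Fintype V] [LinearOrder V]
      (E : Finset (Finset V)) (H : Finset V → ℝ → FermionLattice.Op V) (b : ℝ)
      (τ : ℝ → ℝ → FermionLattice.Op V →L[ℂ] FermionLattice.Op V),
      FermionLattice.IsLocalHamiltonian E H →
      (∀ X ∈ E, ∀ r, ‖H X r‖ ≤ b) →
      FermionLattice.IsPropagator (FermionLattice.totalHamiltonian E H) τ →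
      FermionLattice.liebRobinsonSpeed E H
          ≤ 2 * Real.exp 1 * b * FermionLattice.maxNeighbors E ∧
      ∀ (X Y : Finset V) (A B : FermionLattice.Op V) (s t : ℝ),
        A ∈ FermionLattice.evenAlgebra X → B ∈ FermionLattice.evenAlgebra Y →
        ‖B * τ s t A - τ s t A * B‖
          ≤ p.eval ((min X.card Y.card : ℕ) : ℝ) * ‖B‖ * ‖A‖ *
            FermionLattice.expSub (FermionLattice.liebRobinsonSpeed E H * |t - s|)
              (FermionLattice.graphDist E X Y) := by
  refine ⟨Polynomial.C 2 * Polynomial.X, fun V _ _ E H b τ hH hb hτ =>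
    ⟨FermionLattice.liebRobinsonSpeed_le hb, fun X Y A B s t hA hB => ?_⟩⟩
  simp only [Polynomial.eval_mul, Polynomial.eval_C, Polynomial.eval_X]
  rcases le_total X.card Y.card with h | h
  · rw [min_eq_left h]
    exact (FermionLattice.norm_commutator_propagator_le hH hτ s t A B).trans
      (FermionLattice.norm_commutator_propagator_le_expSub hH hb hτ hA hB s t)
  · rw [min_eq_right h, FermionLattice.graphDist_comm, abs_sub_comm, mul_right_comm _ ‖B‖]
    exact FermionLattice.norm_commutator_propagator_le_expSub hH hb hτ hB hA t s
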